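/- Let $H=\{z\in\mathbb{C}:\operatorname{Im} z>0\}$ and let $f$ be univalent (holomorphic and injective) in $H$. Assume that $f$ extends to a $C^1$ function on $\overline H=\{z:\operatorname{Im} z\ge 0\}$ (one-sided derivatives at boundary points), and for $x\in\partial H=\mathbb{R}$ let $f'(x)$ denote the complex derivative at $x$, relative to $\overline H$, of this extension; it exists and is the limit of $f'(z)$ as $z\to x$, $z\in H$. Let $c$ be a positive number. 1. If $|f'|\le c$ on $\partial H$, then $|f'|\le c$ in $H$. 2. If $|f'|\ge c$ on $\partial H$, then $|f'|\ge c$ in $H$. 3. If $|f'|$ is constant on $\partial H$, then $f'$ is constant in $H$. -/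

import Mathlib

open Set

/-- The closed upper half-plane `{z : Im z ≥ 0}`, the closure of `H`. -/
def closedUpperHalfPlane : Set ℂ := {z : ℂ | 0 ≤ z.im}

/-- `f` is univalent on `U`: holomorphic and injective on `U`. -/
def UnivalentOn (f : ℂ → ℂ) (U : Set ℂ) : Prop :=
  DifferentiableOn ℂ f U ∧ InjOn f U

/-- `F` is a `C¹` extension of `f : H → ℂ` to the closed upper half-plane: it agrees with `f` on
`H`, and it is continuously differentiable in the real sense on the closed half-plane
(one-sidedly at boundary points). -/
def IsC1Extension (f F : ℂ → ℂ) : Prop :=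
  EqOn F f UpperHalfPlane.upperHalfPlaneSet ∧ ContDiffOn ℝ 1 F closedUpperHalfPlane

/-- The value of `f'` at a real boundary point `x`, where `F` is the `C¹` extension of `f`:
the complex derivative of `F` at `x` within the closed upper half-plane. -/
noncomputable def boundaryDeriv (F : ℂ → ℂ) (x : ℝ) : ℂ :=
  derivWithin F closedUpperHalfPlane (x : ℂ)

/-!
The functions `f'` and `1 / f'` are both holomorphic in the half-plane `H`, because an injective
holomorphic function has no critical points, and both extend continuously to the real line under
the respective hypothesis. A bound on the real line passes to `H` by a Phragmén–Lindelöf argument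
as soon as the functions have moderate growth, and univalence is what provides it.

*Moderate growth.* If `g` is univalent in a disc of radius larger than `1` around `0`, then
`|g''(0)| ≤ 80 |g'(0)|` (`UnivalentOn.norm_deriv_deriv_zero_le`), a non-sharp form of Bieberbach's
inequality. Applied to `w ↦ f (z + (Im z / 2) w)` it gives `Im z · |f''(z)| ≤ 160 |f'(z)|` in `H`.
Integrated along a path from `I` to `z`, this bounds both `|f'(z)|` and `1 / |f'(z)|` by a constant
times `(1 + |z|) ^ m / (Im z) ^ n` (`norm_le_of_im_mul_norm_deriv_le`).

*The coefficient bound.* Write `g'(0) / (g - g(0)) = 1 / z + φ`, a univalent function `G` without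
zeros on the punctured disc. Values far from `φ(0)` are already taken by `G` near `0`, so `G` maps
the annulus `r < |z| < 1` into a disc around `φ(0)` whose radius is `1 / r + L r`. The area of the
image, computed in polar coordinates, is `π (1 / r ^ 2 - 1)` plus the integral of `|φ'| ^ 2`, because
`z ^ (-2)` and `φ'` are orthogonal on circles. Comparison with the area of the disc bounds the mean
of `|φ'| ^ 2` on some circle (`exists_circleAverage_norm_deriv_sq_le`), hence `φ - φ(0)` on
`|z| = 1 / 2`, and the absence of zeros of `G` then bounds `φ(0)`, which is `-g''(0) / (2 g'(0))`.

*Phragmén–Lindelöf.* On half-discs of radius `R` the function is multiplied by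
`(1 - z ^ 2 / R ^ 2) ^ n`, which has modulus `(2 Im z / R) ^ n` on the semicircle and at most `1` on
the diameter, and is divided by `(1 - ε I z) ^ (m + 1)`; the maximum principle and the limits
`R → ∞`, `ε → 0` give the claim (`norm_le_of_norm_le_on_real`).

If `|f'|` is constant on the real line, it is constant in `H` by the two bounds, and then `f'` is
constant by the maximum principle.
-/

open Metric Filter Topology MeasureTheory

/-! ### Critical points of univalent functions -/

/-- The derivative of an injective holomorphic function has no zeros: the inverse function is
continuous by the open mapping theorem and holomorphic off a discrete set, so it is holomorphic by
the removable singularity theorem, and the chain rule applies. -/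
theorem UnivalentOn.deriv_ne_zero {f : ℂ → ℂ} {U : Set ℂ} (hf : UnivalentOn f U)
    (hU : IsOpen U) {a : ℂ} (ha : a ∈ U) : deriv f a ≠ 0 := by
  obtain ⟨hd, hi⟩ := hf
  obtain ⟨ε, hε, hsub⟩ := Metric.isOpen_iff.1 hU a ha
  have hd' : DifferentiableOn ℂ f (ball a ε) := hd.mono hsub
  have hi' : InjOn f (ball a ε) := hi.mono hsub
  have han : AnalyticOnNhd ℂ f (ball a ε) := hd'.analyticOnNhd isOpen_ball
  have haB : a ∈ ball a ε := mem_ball_self hε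
  have hnc : ¬ ∃ w, ∀ z ∈ ball a ε, f z = w := by
    rintro ⟨w, hw⟩
    have hb : a + (ε / 2 : ℝ) ∈ ball a ε := by
      simp [abs_of_pos hε, hε]
    have := hi' hb haB ((hw _ hb).trans (hw _ haB).symm)
    simp at this
    exact hε.ne' this
  have hopen : ∀ s ⊆ ball a ε, IsOpen s → IsOpen (f '' s) := by
    rcases han.is_constant_or_isOpen (convex_ball a ε).isPreconnected with h | h
    · exact absurd h hnc
    · exact h
  set g := Function.invFunOn f (ball a ε) with hg
  have hgf : ∀ z ∈ ball a ε, g (f z) = z := fun z hz => hi'.leftInvOn_invFunOn hz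
  have hgc : ∀ z ∈ ball a ε, ContinuousAt g (f z) := by
    intro z hz
    rw [ContinuousAt, hgf z hz, tendsto_def]
    intro s hs
    obtain ⟨t, hts, hto, hzt⟩ := _root_.mem_nhds_iff.1 (inter_mem hs (isOpen_ball.mem_nhds hz))
    have : f '' t ∈ 𝓝 (f z) :=
      (hopen t (fun x hx => (hts hx).2) hto).mem_nhds ⟨z, hzt, rfl⟩
    filter_upwards [this]
    rintro _ ⟨x, hx, rfl⟩
    simpa [hgf x (hts hx).2] using (hts hx).1
  have hfg : ∀ z ∈ ball a ε, ∀ᶠ w in 𝓝 (f z), f (g w) = w ∧ g w ∈ ball a ε := by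
    intro z hz
    filter_upwards [(hopen _ Subset.rfl isOpen_ball).mem_nhds ⟨z, hz, rfl⟩]
    rintro _ ⟨x, hx, rfl⟩
    simp [hgf x hx, hx]
  have hne : ∀ᶠ z in 𝓝[≠] a, deriv f z ≠ 0 := by
    rcases (han a haB).deriv.eventually_eq_zero_or_eventually_ne_zero with h | h
    · exfalso
      have h0 : EqOn (deriv f) 0 (ball a ε) :=
        han.deriv.eqOn_zero_of_preconnected_of_eventuallyEq_zero
          (convex_ball a ε).isPreconnected haB h
      refine hnc ⟨f a, fun z hz => ?_⟩
      exact isOpen_ball.is_const_of_deriv_eq_zero (convex_ball a ε).isPreconnected hd' h0 hz haB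
    · exact h
  have hgd : ∀ᶠ w in 𝓝[≠] f a, DifferentiableAt ℂ g w := by
    have ht : Tendsto g (𝓝[≠] f a) (𝓝[≠] a) := by
      refine tendsto_nhdsWithin_iff.2 ⟨?_, ?_⟩
      · have := hgc a haB
        rw [ContinuousAt, hgf a haB] at this
        exact this.mono_left nhdsWithin_le_nhds
      · filter_upwards [self_mem_nhdsWithin, nhdsWithin_le_nhds (hfg a haB)] with w hw hw'
        intro h
        simp only [mem_singleton_iff] at h
        exact hw (by rw [mem_singleton_iff, ← hw'.1, h])
    filter_upwards [ht.eventually hne, nhdsWithin_le_nhds (hfg a haB)] with w hw hw'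
    have hw2 := hgc (g w) hw'.2
    have hw3 := hfg (g w) hw'.2
    rw [hw'.1] at hw2 hw3
    exact (HasDerivAt.of_local_left_inverse hw2
      (hd'.differentiableAt (isOpen_ball.mem_nhds hw'.2)).hasDerivAt hw
      (hw3.mono fun _ h => h.1)).differentiableAt
  have hga : DifferentiableAt ℂ g (f a) :=
    (Complex.analyticAt_of_differentiable_on_punctured_nhds_of_continuousAt hgd
      (hgc a haB)).differentiableAt
  intro h0
  have hfa := (hd'.differentiableAt (isOpen_ball.mem_nhds haB)).hasDerivAt
  have h1 : HasDerivAt (g ∘ f) (deriv g (f a) * deriv f a) a := hga.hasDerivAt.comp a hfa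
  have h2 : HasDerivAt (g ∘ f) 1 a :=
    (hasDerivAt_id a).congr_of_eventuallyEq
      (by filter_upwards [isOpen_ball.mem_nhds haB] with z hz using hgf z hz)
  have := h1.unique h2
  simp [h0] at this

/-! ### Values of a function near a simple pole -/

/-- Values far from `φ 0` are taken by `1 / z + φ z` near its pole: `1 / z + φ z = w` is the fixed
point equation for `z ↦ (1 + z (φ z - φ 0)) / (w - φ 0)`, which is a contraction of a small disc. -/
theorem exists_inv_add_eq {φ : ℂ → ℂ} {L r : ℝ} (hL : 0 < L) (hr : 0 < r) (hr1 : 2 * L * r ^ 2 < 1)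
    (hφ : ∀ z ∈ closedBall (0 : ℂ) r, ∀ w ∈ closedBall (0 : ℂ) r, ‖φ z - φ w‖ ≤ L * ‖z - w‖)
    {w : ℂ} (hw : 1 / r + L * r < ‖w - φ 0‖) :
    ∃ z ∈ closedBall (0 : ℂ) r, z ≠ 0 ∧ z⁻¹ + φ z = w := by
  set s := w - φ 0 with hs
  have hspos : 0 < ‖s‖ := lt_trans (by positivity) hw
  have hs0 : s ≠ 0 := norm_pos_iff.1 hspos
  have h0 : (0 : ℂ) ∈ closedBall (0 : ℂ) r := by simp [hr.le]
  have hψ : ∀ z ∈ closedBall (0 : ℂ) r, ‖φ z - φ 0‖ ≤ L * r := by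
    intro z hz
    have := hφ z hz 0 h0
    rw [mem_closedBall_zero_iff] at hz
    rw [sub_zero] at this
    exact this.trans (by gcongr)
  set T : ℂ → ℂ := fun z => (1 + z * (φ z - φ 0)) / s with hT
  have hmaps : MapsTo T (closedBall 0 r) (closedBall 0 r) := by
    intro z hz
    have h1 := hψ z hz
    rw [mem_closedBall_zero_iff] at hz ⊢
    rw [hT]
    simp only [norm_div]
    rw [div_le_iff₀ hspos]
    calc ‖1 + z * (φ z - φ 0)‖ ≤ ‖(1 : ℂ)‖ + ‖z * (φ z - φ 0)‖ := norm_add_le _ _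
      _ ≤ 1 + r * (L * r) := by rw [norm_one, norm_mul]; gcongr
      _ = r * (1 / r + L * r) := by field_simp
      _ ≤ r * ‖s‖ := by gcongr
  have hK : (0 : ℝ) ≤ 2 * L * r ^ 2 := by positivity
  have hlip : ∀ x ∈ closedBall (0 : ℂ) r, ∀ y ∈ closedBall (0 : ℂ) r,
      ‖T x - T y‖ ≤ 2 * L * r ^ 2 * ‖x - y‖ := by
    intro x hx y hy
    have e : T x - T y = (x * (φ x - φ y) + (x - y) * (φ y - φ 0)) / s := by
      simp only [hT]; field_simp; ring
    have h1 : 1 ≤ r * ‖s‖ := by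
      calc 1 = r * (1 / r) := by field_simp
        _ ≤ r * ‖s‖ := by
          gcongr
          have : 0 < L * r := by positivity
          linarith
    rw [e, norm_div, div_le_iff₀ hspos]
    have hx' := mem_closedBall_zero_iff.1 hx
    calc ‖x * (φ x - φ y) + (x - y) * (φ y - φ 0)‖
        ≤ ‖x‖ * ‖φ x - φ y‖ + ‖x - y‖ * ‖φ y - φ 0‖ := by
          rw [← norm_mul, ← norm_mul]; exact norm_add_le _ _
      _ ≤ r * (L * ‖x - y‖) + ‖x - y‖ * (L * r) := by
          gcongr
          · exact hφ x hx y hy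
          · exact hψ y hy
      _ = 2 * L * r * ‖x - y‖ * 1 := by ring
      _ ≤ 2 * L * r * ‖x - y‖ * (r * ‖s‖) := by gcongr
      _ = 2 * L * r ^ 2 * ‖x - y‖ * ‖s‖ := by ring
  have hcontr : ContractingWith ⟨2 * L * r ^ 2, hK⟩ (hmaps.restrict T _ _) := by
    refine ⟨by exact_mod_cast hr1, LipschitzWith.of_dist_le_mul ?_⟩
    rintro ⟨x, hx⟩ ⟨y, hy⟩
    rw [Subtype.dist_eq, Subtype.dist_eq, dist_eq_norm, dist_eq_norm]
    exact hlip x hx y hy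
  obtain ⟨z, hz, hfix, -⟩ :=
    hcontr.exists_fixedPoint' isClosed_closedBall.isComplete hmaps h0 (edist_ne_top _ _)
  have hfix' : (1 + z * (φ z - φ 0)) / s = z := hfix
  have hz0 : z ≠ 0 := by
    rintro rfl
    simp [hs0] at hfix'
  refine ⟨z, hz, hz0, ?_⟩
  rw [div_eq_iff hs0, hs] at hfix'
  field_simp
  linear_combination hfix'

/-! ### Area of the image and polar coordinates -/

/-- The real Jacobian of a holomorphic function is `‖f'‖ ^ 2`, so that `∫ ‖f'‖ ^ 2` is the area of
the image when `f` is injective. -/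
theorem UnivalentOn.integral_norm_deriv_sq_le {f : ℂ → ℂ} {S : Set ℂ} (hf : UnivalentOn f S)
    (hS : IsOpen S) {c : ℂ} {M : ℝ} (hM : 0 ≤ M) (hsub : MapsTo f S (closedBall c M)) :
    ∫ z in S, ‖deriv f z‖ ^ 2 ≤ Real.pi * M ^ 2 := by
  obtain ⟨hd, hi⟩ := hf
  have h1 := integral_image_eq_integral_abs_det_fderiv_smul (μ := (volume : Measure ℂ))
    hS.measurableSet (f := f)
    (f' := fun z => (ContinuousLinearMap.toSpanSingleton ℂ (deriv f z)).restrictScalars ℝ)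
    (fun z hz => (((hd.differentiableAt (hS.mem_nhds hz)).hasDerivAt.hasFDerivAt).restrictScalars
      ℝ).hasFDerivWithinAt) hi (fun _ => (1 : ℝ))
  have h2 : ∀ z : ℂ, |((ContinuousLinearMap.toSpanSingleton ℂ (deriv f z)).restrictScalars ℝ).det|
      • (1 : ℝ) = ‖deriv f z‖ ^ 2 := by
    intro z
    simp [ContinuousLinearMap.det, LinearMap.det_restrictScalars,
      Algebra.norm_complex_eq, Complex.normSq_eq_norm_sq]
  simp only [h2] at h1
  rw [← h1]
  simp only [integral_const, smul_eq_mul, mul_one]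
  calc (volume.restrict (f '' S)).real univ = volume.real (f '' S) := by simp [Measure.real]
    _ ≤ volume.real (closedBall c M) := measureReal_mono hsub.image_subset (by
        exact measure_closedBall_lt_top.ne)
    _ = Real.pi * M ^ 2 := by
      simp [Measure.real, Complex.volume_closedBall, hM, mul_comm]

/-- Integration over an annulus in polar coordinates. -/
theorem integral_annulus_eq {F : ℂ → ℝ} {r : ℝ} (hr : 0 < r) (hr1 : r ≤ 1)
    (hF : ContinuousOn F {z | r ≤ ‖z‖ ∧ ‖z‖ ≤ 1}) :
    ∫ z in {z : ℂ | r < ‖z‖ ∧ ‖z‖ < 1}, F z =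
      ∫ ρ in r..1, ρ * (2 * Real.pi * Real.circleAverage F 0 ρ) := by
  have hA : MeasurableSet {z : ℂ | r < ‖z‖ ∧ ‖z‖ < 1} :=
    ((isOpen_lt continuous_const continuous_norm).inter
      (isOpen_lt continuous_norm continuous_const)).measurableSet
  have hP : MeasurableSet (Ioo r 1 ×ˢ Ioo (-Real.pi) Real.pi) :=
    measurableSet_Ioo.prod measurableSet_Ioo
  have hcm : ∀ p : ℝ × ℝ, Complex.polarCoord.symm p = circleMap 0 p.1 p.2 := by
    intro p
    rw [Complex.polarCoord_symm_apply, circleMap, Complex.exp_mul_I]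
    simp
  rw [← integral_indicator hA, ← Complex.integral_comp_polarCoord_symm]
  have h1 : ∫ p in polarCoord.target, p.1 • ({z : ℂ | r < ‖z‖ ∧ ‖z‖ < 1}.indicator F)
      (Complex.polarCoord.symm p) =
      ∫ p in Ioo r 1 ×ˢ Ioo (-Real.pi) Real.pi, p.1 * F (circleMap 0 p.1 p.2) := by
    rw [← integral_indicator hP, ← integral_indicator polarCoord.open_target.measurableSet]
    congr 1
    ext p
    simp only [indicator, hcm, polarCoord_target, mem_prod, mem_Ioi, mem_Ioo, mem_ofPred_eq,
      smul_eq_mul]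
    by_cases h0 : 0 < p.1
    · simp only [norm_circleMap_zero, abs_of_pos h0, h0, true_and]
      split_ifs <;> simp_all
    · have : ¬ r < p.1 := fun h => h0 (hr.trans h)
      simp [h0, this]
  have hcont : ContinuousOn (fun p : ℝ × ℝ => p.1 * F (circleMap 0 p.1 p.2))
      (Icc r 1 ×ˢ Icc (-Real.pi) Real.pi) := by
    refine continuousOn_fst.mul (hF.comp (by
      unfold circleMap; fun_prop) ?_)
    rintro ⟨a, b⟩ ⟨ha, -⟩
    simp only [mem_ofPred_eq, norm_circleMap_zero]
    rw [abs_of_pos (hr.trans_le ha.1)]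
    exact ha
  have hint : IntegrableOn (fun p : ℝ × ℝ => p.1 * F (circleMap 0 p.1 p.2))
      (Ioo r 1 ×ˢ Ioo (-Real.pi) Real.pi) (volume.prod volume) :=
    (hcont.integrableOn_compact (isCompact_Icc.prod isCompact_Icc)).mono_set
      (prod_mono Ioo_subset_Icc_self Ioo_subset_Icc_self)
  rw [h1, Measure.volume_eq_prod, setIntegral_prod _ hint,
    intervalIntegral.integral_of_le hr1, ← integral_Ioc_eq_integral_Ioo]
  refine integral_congr_ae (Eventually.of_forall fun ρ => ?_)
  simp only [integral_const_mul]
  congr 1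
  rw [Real.circleAverage_eq_integral_add (-Real.pi),
    intervalIntegral.integral_comp_add_right (fun θ => F (circleMap 0 ρ θ)),
    ← integral_Ioc_eq_integral_Ioo, ← intervalIntegral.integral_of_le (by linarith [Real.pi_pos])]
  have : 2 * Real.pi + -Real.pi = Real.pi := by ring
  rw [zero_add, this, smul_eq_mul]
  field_simp

/-! ### A non-sharp area theorem -/

theorem norm_circleAverage_le {f : ℂ → ℂ} {c : ℂ} {R : ℝ} :
    ‖Real.circleAverage f c R‖ ≤ Real.circleAverage (fun z => ‖f z‖) c R := by
  rw [Real.circleAverage, Real.circleAverage, norm_smul, smul_eq_mul,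
    Real.norm_of_nonneg (by positivity)]
  gcongr
  exact intervalIntegral.norm_integral_le_integral_norm (by positivity)

/-- Orthogonality of `z⁻²` and the derivative of a holomorphic function in the mean on a circle: the
cross term is the real part of a multiple of `z ^ 2 * ψ z`, whose mean is its value `0` at `0`. -/
theorem circleAverage_norm_sub_inv_sq {ψ : ℂ → ℂ} {R ρ : ℝ} (hψ : DifferentiableOn ℂ ψ (ball 0 R))
    (hρ : 0 < ρ) (hρR : ρ < R) :
    Real.circleAverage (fun z => ‖ψ z - (z ^ 2)⁻¹‖ ^ 2) 0 ρ =
      (ρ ^ 4)⁻¹ + Real.circleAverage (fun z => ‖ψ z‖ ^ 2) 0 ρ := by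
  have hsub : closedBall (0 : ℂ) ρ ⊆ ball 0 R := closedBall_subset_ball hρR
  have hsph : sphere (0 : ℂ) |ρ| ⊆ ball 0 R := by
    rw [abs_of_pos hρ]; exact sphere_subset_closedBall.trans hsub
  have hc : ContinuousOn ψ (sphere 0 |ρ|) := hψ.continuousOn.mono hsph
  have hd : DifferentiableOn ℂ (fun z => z ^ 2 * ψ z) (ball 0 R) :=
    (differentiableOn_id.pow 2).mul hψ
  have h0 : Real.circleAverage (fun z => z ^ 2 * ψ z) 0 ρ = 0 := by
    have : DiffContOnCl ℂ (fun z => z ^ 2 * ψ z) (ball 0 |ρ|) := by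
      rw [abs_of_pos hρ]
      exact (hd.mono (by rw [closure_ball _ hρ.ne']; exact hsub)).diffContOnCl
    rw [this.circleAverage]
    simp
  have i1 : CircleIntegrable (fun z => ‖ψ z‖ ^ 2) 0 ρ :=
    (hc.norm.pow 2).circleIntegrable'
  have i2 : CircleIntegrable (fun z => z ^ 2 * ψ z) 0 ρ :=
    ((continuousOn_id.pow 2).mul hc).circleIntegrable'
  have i3 : CircleIntegrable (fun z => (-2 * (ρ ^ 4)⁻¹) • Complex.reCLM (z ^ 2 * ψ z)) 0 ρ := by
    have := (Complex.reCLM.continuous.comp_continuousOn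
      ((continuousOn_id.pow 2).mul hc)).const_smul (-2 * (ρ ^ 4)⁻¹)
    exact this.circleIntegrable'
  have h1 : Real.circleAverage (fun z => (-2 * (ρ ^ 4)⁻¹) • Complex.reCLM (z ^ 2 * ψ z)) 0 ρ
      = 0 := by
    rw [Real.circleAverage_fun_smul]
    have := Complex.reCLM.circleAverage_comp_comm i2
    simp only [Function.comp_def] at this
    rw [this, h0]
    simp
  have h2 : Real.circleAverage (fun z => ‖ψ z - (z ^ 2)⁻¹‖ ^ 2) 0 ρ =
      Real.circleAverage (fun z => (ρ ^ 4)⁻¹ + (‖ψ z‖ ^ 2 +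
        (-2 * (ρ ^ 4)⁻¹) • Complex.reCLM (z ^ 2 * ψ z))) 0 ρ := by
    refine Real.circleAverage_congr_sphere fun z hz => ?_
    rw [abs_of_pos hρ, mem_sphere_zero_iff_norm] at hz
    have hz0 : z ≠ 0 := norm_pos_iff.1 (hz ▸ hρ)
    have e1 : Complex.normSq (ψ z - (z ^ 2)⁻¹) = Complex.normSq (ψ z) +
        Complex.normSq ((z ^ 2)⁻¹) - 2 * (ψ z * (starRingEnd ℂ) ((z ^ 2)⁻¹)).re :=
      Complex.normSq_sub _ _
    have e2 : (starRingEnd ℂ) ((z ^ 2)⁻¹) = ((ρ ^ 4)⁻¹ : ℝ) * z ^ 2 := by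
      rw [Complex.inv_def, map_mul, Complex.conj_conj, Complex.conj_ofReal,
        Complex.normSq_eq_norm_sq, norm_pow, hz, mul_comm, ← pow_mul]
    have e3 : (ψ z * (starRingEnd ℂ) ((z ^ 2)⁻¹)).re = (ρ ^ 4)⁻¹ * (z ^ 2 * ψ z).re := by
      rw [e2, ← Complex.re_ofReal_mul]
      congr 1; ring
    rw [e3] at e1
    simp only [← Complex.normSq_eq_norm_sq, e1]
    simp only [Complex.reCLM_apply, smul_eq_mul]
    rw [Complex.normSq_eq_norm_sq ((z ^ 2)⁻¹), norm_inv, norm_pow, hz]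
    field_simp
    ring
  have i4 : CircleIntegrable (fun z => ‖ψ z‖ ^ 2 +
      (-2 * (ρ ^ 4)⁻¹) • Complex.reCLM (z ^ 2 * ψ z)) 0 ρ := i1.add i3
  rw [h2, Real.circleAverage_fun_add (circleIntegrable_const _ _ _) i4,
    Real.circleAverage_const, Real.circleAverage_fun_add i1 i3, h1, add_zero]

/-- The mean value property of `ψ ^ 2`. -/
theorem sq_norm_le_circleAverage {ψ : ℂ → ℂ} {R ρ : ℝ} (hψ : DifferentiableOn ℂ ψ (ball 0 R))
    (hρ : 0 < ρ) (hρR : ρ < R) :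
    ‖ψ 0‖ ^ 2 ≤ Real.circleAverage (fun z => ‖ψ z‖ ^ 2) 0 ρ := by
  have : DiffContOnCl ℂ (fun z => ψ z ^ 2) (ball 0 |ρ|) := by
    rw [abs_of_pos hρ]
    exact ((hψ.pow 2).mono (by
      rw [closure_ball _ hρ.ne']; exact closedBall_subset_ball hρR)).diffContOnCl
  have h := norm_circleAverage_le (f := fun z => ψ z ^ 2) (c := 0) (R := ρ)
  rw [this.circleAverage] at h
  simpa only [norm_pow] using h

/-- A non-sharp area theorem: the mean of `‖φ'‖ ^ 2` is controlled on some circle. The image of the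
annulus `r < ‖z‖ < 1` lies in a disc of radius `1 / r + L r`, so its area
`π (1 / r ^ 2 - 1) + ∫ ‖φ'‖ ^ 2` is at most `π / r ^ 2 + O(1)`. -/
theorem exists_circleAverage_norm_deriv_sq_le {φ : ℂ → ℂ} {R : ℝ} (hR : 1 < R)
    (hφ : DifferentiableOn ℂ φ (ball 0 R))
    (hinj : InjOn (fun z => z⁻¹ + φ z) (ball 0 R \ {0})) :
    ∃ ρ ∈ Icc (3 / 4 : ℝ) 1, Real.circleAverage (fun z => ‖deriv φ z‖ ^ 2) 0 ρ ≤ 42 := by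
  have hdφ : DifferentiableOn ℂ (deriv φ) (ball 0 R) := hφ.deriv isOpen_ball
  set m : ℝ → ℝ := Real.circleAverage (fun z => ‖deriv φ z‖ ^ 2) 0 with hm
  set L : ℝ := ‖deriv φ 0‖ + 1 with hL
  have hL1 : 1 ≤ L := by simp [hL]
  have hmb : ∀ ρ ∈ Icc (3 / 4 : ℝ) 1, (L - 1) ^ 2 ≤ m ρ := by
    intro ρ hρ
    have := sq_norm_le_circleAverage hdφ (ρ := ρ) (by linarith [hρ.1]) (by linarith [hρ.2])
    simpa [hL] using this
  -- It suffices to bound the mean in terms of `L`, because the mean dominates `(L - 1) ^ 2`.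
  suffices h : ∃ ρ ∈ Icc (3 / 4 : ℝ) 1, m ρ ≤ 16 / 7 * (2 + 2 * L) by
    obtain ⟨ρ, hρ, h⟩ := h
    have h' := hmb ρ hρ
    have hL8 : L ≤ 8 := by nlinarith
    exact ⟨ρ, hρ, by linarith⟩
  by_contra! hcon
  -- A radius on which `φ` is `L`-Lipschitz.
  have h0R : (0 : ℂ) ∈ ball (0 : ℂ) R := mem_ball_self (by linarith)
  have hst : HasStrictDerivAt φ (deriv φ 0) 0 :=
    (hφ.analyticOnNhd isOpen_ball 0 h0R).hasStrictDerivAt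
  obtain ⟨t, ht, hlip⟩ := hst.hasStrictFDerivAt.exists_lipschitzOnWith_of_nnnorm_lt
    (‖deriv φ 0‖₊ + 1) (by
      rw [← NNReal.coe_lt_coe]
      simp)
  obtain ⟨δ, hδ, hδt⟩ := Metric.nhds_basis_closedBall.mem_iff.1 ht
  set r : ℝ := min δ (1 / (2 * L)) with hr
  have hr0 : 0 < r := lt_min hδ (by positivity)
  have hrL : L * r ≤ 1 / 2 := by
    calc L * r ≤ L * (1 / (2 * L)) := by gcongr; exact min_le_right _ _
      _ = 1 / 2 := by field_simp
  have hr2 : r ≤ 1 / 2 := by nlinarith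
  have hφL : ∀ z ∈ closedBall (0 : ℂ) r, ∀ w ∈ closedBall (0 : ℂ) r,
      ‖φ z - φ w‖ ≤ L * ‖z - w‖ := by
    intro z hz w hw
    have hs : closedBall (0 : ℂ) r ⊆ t := (closedBall_subset_closedBall (min_le_left _ _)).trans hδt
    have := hlip.dist_le_mul z (hs hz) w (hs hw)
    rwa [dist_eq_norm, dist_eq_norm] at this
  set G : ℂ → ℂ := fun z => z⁻¹ + φ z with hG
  set A : Set ℂ := {z | r < ‖z‖ ∧ ‖z‖ < 1} with hA
  have hAo : IsOpen A := (isOpen_lt continuous_const continuous_norm).inter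
      (isOpen_lt continuous_norm continuous_const)
  have hAsub : A ⊆ ball 0 R \ {0} := by
    rintro z ⟨h1, h2⟩
    refine ⟨by simp; linarith, ?_⟩
    rintro rfl
    simp at h1; linarith
  have hne : ∀ z ∈ ball (0 : ℂ) R \ {0}, HasDerivAt G (deriv φ z - (z ^ 2)⁻¹) z := by
    intro z hz
    have := (hasDerivAt_inv (𝕜 := ℂ) hz.2).add
      (hφ.differentiableAt (isOpen_ball.mem_nhds hz.1)).hasDerivAt
    rwa [neg_add_eq_sub] at this
  -- A value outside this disc is taken by `G` inside `‖z‖ ≤ r`, and `G` is injective.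
  have hmaps : MapsTo G A (closedBall (φ 0) (1 / r + L * r)) := by
    intro z hz
    by_contra hcon
    rw [mem_closedBall, not_le, dist_eq_norm] at hcon
    obtain ⟨w, hw, hw0, hwz⟩ := exists_inv_add_eq (by linarith) hr0 (by nlinarith) hφL hcon
    have hwR : w ∈ ball (0 : ℂ) R \ {0} :=
      ⟨closedBall_subset_ball (by linarith) hw, hw0⟩
    have := hinj hwR (hAsub hz) hwz
    rw [this, mem_closedBall_zero_iff] at hw
    exact absurd hz.1 (not_lt.2 hw)
  have hunivG : UnivalentOn G A :=
    ⟨fun z hz => (hne z (hAsub hz)).differentiableAt.differentiableWithinAt, hinj.mono hAsub⟩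
  have harea := hunivG.integral_norm_deriv_sq_le hAo (by positivity) hmaps
  -- The area in polar coordinates.
  have hclosed : {z : ℂ | r ≤ ‖z‖ ∧ ‖z‖ ≤ 1} ⊆ ball 0 R \ {0} := by
    rintro z ⟨h1, h2⟩
    refine ⟨by simp; linarith, ?_⟩
    rintro rfl
    simp at h1; linarith
  have hpolar : ∫ z in A, ‖deriv G z‖ ^ 2 =
      ∫ ρ in r..1, 2 * Real.pi * ((ρ ^ 3)⁻¹ + ρ * m ρ) := by
    have e1 : ∫ z in A, ‖deriv G z‖ ^ 2 = ∫ z in A, ‖deriv φ z - (z ^ 2)⁻¹‖ ^ 2 :=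
      setIntegral_congr_fun hAo.measurableSet fun z hz => by
        simp only [(hne z (hAsub hz)).deriv]
    rw [e1, integral_annulus_eq hr0 (by linarith)]
    · refine intervalIntegral.integral_congr fun ρ hρ => ?_
      rw [uIcc_of_le (by linarith)] at hρ
      have hρ0 : 0 < ρ := hr0.trans_le hρ.1
      rw [circleAverage_norm_sub_inv_sq hdφ hρ0 (by linarith [hρ.2])]
      field_simp
      rw [hm]
    · refine ((hdφ.continuousOn.mono (hclosed.trans sdiff_subset)).sub
        (ContinuousOn.inv₀ (continuousOn_id.pow 2) fun z hz => ?_)).norm.pow 2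
      exact pow_ne_zero 2 (hclosed hz).2
  have hmcont : ContinuousOn m (Icc r 1) := by
    refine Real.ContinuousOn.circleAverage ?_ fun ρ hρ => hr0.le.trans hρ.1
    refine (hdφ.continuousOn.mono ?_).norm.pow 2
    intro z hz
    simp only [sub_zero, mem_ofPred_eq, mem_Icc] at hz
    simp; linarith
  have hfc : ContinuousOn (fun ρ => 2 * Real.pi * ((ρ ^ 3)⁻¹ + ρ * m ρ)) (Icc r 1) := by
    refine continuousOn_const.mul ((ContinuousOn.inv₀ (continuousOn_id.pow 3) fun z hz => ?_).add
      (continuousOn_id.mul hmcont))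
    exact pow_ne_zero 3 (hr0.trans_le hz.1).ne'
  have hsplit := intervalIntegral.integral_add_adjacent_intervals (a := r) (b := 3 / 4) (c := 1)
    (f := fun ρ => 2 * Real.pi * ((ρ ^ 3)⁻¹ + ρ * m ρ)) (μ := volume)
    ((hfc.mono (Icc_subset_Icc_right (by norm_num))).intervalIntegrable_of_Icc (by linarith))
    ((hfc.mono (Icc_subset_Icc_left (by linarith))).intervalIntegrable_of_Icc (by norm_num))
  have hprim : ∀ X a b : ℝ, 0 < a → a ≤ b →
      ∫ ρ in a..b, 2 * Real.pi * ((ρ ^ 3)⁻¹ + ρ * X) =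
        Real.pi * (X * b ^ 2 - (b ^ 2)⁻¹) - Real.pi * (X * a ^ 2 - (a ^ 2)⁻¹) := by
    intro X a b ha hab
    refine intervalIntegral.integral_eq_sub_of_hasDerivAt
      (f := fun ρ => Real.pi * (X * ρ ^ 2 - (ρ ^ 2)⁻¹)) (fun x hx => ?_) ?_
    · rw [uIcc_of_le hab] at hx
      have hx0 : x ≠ 0 := (ha.trans_le hx.1).ne'
      have := (((hasDerivAt_pow 2 x).const_mul X).sub
        ((hasDerivAt_pow 2 x).inv (pow_ne_zero 2 hx0))).const_mul Real.pi
      refine HasDerivAt.congr_deriv this ?_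
      field_simp
      push_cast
      ring
    · refine ContinuousOn.intervalIntegrable_of_Icc hab (continuousOn_const.mul
        ((ContinuousOn.inv₀ (continuousOn_id.pow 3) fun z hz => ?_).add
          (continuousOn_id.mul continuousOn_const)))
      exact pow_ne_zero 3 (ha.trans_le hz.1).ne'
  have hcX : ∀ X a : ℝ, 0 < a → ContinuousOn (fun ρ : ℝ => 2 * Real.pi * ((ρ ^ 3)⁻¹ + ρ * X))
      (Icc a 1) := fun X a ha => continuousOn_const.mul
        ((ContinuousOn.inv₀ (continuousOn_id.pow 3)
          fun z hz => pow_ne_zero 3 (ha.trans_le hz.1).ne').add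
          (continuousOn_id.mul continuousOn_const))
  -- The mean is bounded below by `0` on `[r, 3 / 4]`, and by the negated claim on `[3 / 4, 1]`.
  have hlow1 : ∫ ρ in r..3 / 4, 2 * Real.pi * ((ρ ^ 3)⁻¹ + ρ * 0) ≤
      ∫ ρ in r..3 / 4, 2 * Real.pi * ((ρ ^ 3)⁻¹ + ρ * m ρ) := by
    refine intervalIntegral.integral_mono_on (by linarith)
      (((hcX 0 r hr0).mono (Icc_subset_Icc_right (by norm_num))).intervalIntegrable_of_Icc
        (by linarith))
      ((hfc.mono (Icc_subset_Icc_right (by norm_num))).intervalIntegrable_of_Icc (by linarith))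
      fun ρ hρ => ?_
    have hρ0 : 0 < ρ := hr0.trans_le hρ.1
    have : 0 ≤ m ρ := Real.circleAverage_nonneg_of_nonneg fun z _ => by positivity
    gcongr
  have hlow2 : ∫ ρ in (3 / 4 : ℝ)..1, 2 * Real.pi * ((ρ ^ 3)⁻¹ + ρ * (16 / 7 * (2 + 2 * L))) ≤
      ∫ ρ in (3 / 4 : ℝ)..1, 2 * Real.pi * ((ρ ^ 3)⁻¹ + ρ * m ρ) := by
    refine intervalIntegral.integral_mono_on (by norm_num)
      ((hcX _ _ (by norm_num)).intervalIntegrable_of_Icc (by norm_num))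
      ((hfc.mono (Icc_subset_Icc_left (by linarith))).intervalIntegrable_of_Icc (by norm_num))
      fun ρ hρ => ?_
    have hρ0 : 0 < ρ := by linarith [hρ.1]
    have := (hcon ρ hρ).le
    gcongr
  rw [hprim _ _ _ hr0 (by linarith)] at hlow1
  rw [hprim _ _ _ (by norm_num) (by norm_num)] at hlow2
  have hfin : Real.pi * ((r ^ 2)⁻¹ + 1 + 2 * L) ≤ Real.pi * (1 / r + L * r) ^ 2 := by
    rw [hpolar, ← hsplit] at harea
    refine le_trans ?_ harea
    refine le_trans (le_of_eq ?_) (add_le_add hlow1 hlow2)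
    ring
  have := le_of_mul_le_mul_left hfin Real.pi_pos
  have e : (1 / r + L * r) ^ 2 = (r ^ 2)⁻¹ + 2 * L + (L * r) ^ 2 := by field_simp; ring
  have h4 : (L * r) ^ 2 ≤ (1 / 2) ^ 2 := by gcongr
  linarith

/-! ### The second coefficient -/

/-- For a univalent function `1 / z + φ z` without zeros, `φ 0` is bounded: otherwise
`1 + z * φ z` would be large on the circle `‖z‖ = 1 / 2`, against the maximum principle for its
inverse, whose value at `0` is `1`. -/
theorem norm_apply_zero_le_of_injOn {φ : ℂ → ℂ} {R : ℝ} (hR : 1 < R)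
    (hφ : DifferentiableOn ℂ φ (ball 0 R))
    (hinj : InjOn (fun z => z⁻¹ + φ z) (ball 0 R \ {0}))
    (hN : ∀ z ∈ ball (0 : ℂ) R, 1 + z * φ z ≠ 0) : ‖φ 0‖ ≤ 40 := by
  obtain ⟨ρ, ⟨hρ1, hρ2⟩, hρ⟩ := exists_circleAverage_norm_deriv_sq_le hR hφ hinj
  have hρ0 : 0 < ρ := by linarith
  have hdφ : DifferentiableOn ℂ (deriv φ) (ball 0 R) := hφ.deriv isOpen_ball
  have hsub : closedBall (0 : ℂ) ρ ⊆ ball 0 R := closedBall_subset_ball (by linarith)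
  have hcl : DiffContOnCl ℂ (deriv φ) (ball 0 |ρ|) := by
    rw [abs_of_pos hρ0]
    exact (hdφ.mono (by rw [closure_ball _ hρ0.ne']; exact hsub)).diffContOnCl
  have hcont : ContinuousOn (deriv φ) (sphere 0 |ρ|) := by
    rw [abs_of_pos hρ0]
    exact hdφ.continuousOn.mono (sphere_subset_closedBall.trans hsub)
  have hderiv : ∀ ζ ∈ closedBall (0 : ℂ) (1 / 2), ‖deriv φ ζ‖ ≤ 66 := by
    -- By Cauchy's formula on the circle of radius `ρ ≥ 3 / 4`, with kernel bounded by `3`, and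
    -- `t ≤ (1 + t ^ 2) / 2`.
    intro ζ hζ
    rw [mem_closedBall_zero_iff] at hζ
    have hk : ∀ z ∈ sphere (0 : ℂ) |ρ|, ρ - 1 / 2 ≤ ‖z - ζ‖ := by
      intro z hz
      rw [abs_of_pos hρ0, mem_sphere_zero_iff_norm] at hz
      have := norm_sub_norm_le z ζ
      linarith
    have i1 : CircleIntegrable (fun z => ‖((z - 0) / (z - ζ)) • deriv φ z‖) 0 ρ := by
      refine ContinuousOn.circleIntegrable' (ContinuousOn.norm (ContinuousOn.smul
        ((continuousOn_id.sub continuousOn_const).div (continuousOn_id.sub continuousOn_const)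
          fun z hz h => ?_) hcont))
      have := hk z hz
      rw [show z - ζ = 0 from h, norm_zero] at this
      linarith
    have i2 : CircleIntegrable (fun z => ‖deriv φ z‖ ^ 2) 0 ρ :=
      (hcont.norm.pow 2).circleIntegrable'
    have i3 : CircleIntegrable (fun z => (3 / 2 : ℝ) • (1 + ‖deriv φ z‖ ^ 2)) 0 ρ := by
      have := (continuousOn_const (c := (1 : ℝ)).add (hcont.norm.pow 2)).const_smul (3 / 2 : ℝ)
      exact this.circleIntegrable'
    have h1 := hcl.circleAverage_smul_div (w := ζ) (by
      rw [abs_of_pos hρ0, mem_ball_zero_iff]; linarith)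
    rw [← h1]
    refine norm_circleAverage_le.trans ((Real.circleAverage_mono i1 i3 fun z hz => ?_).trans ?_)
    · have hz' := hk z hz
      rw [abs_of_pos hρ0, mem_sphere_zero_iff_norm] at hz
      rw [norm_smul, norm_div, sub_zero, hz, smul_eq_mul]
      have e : ρ / ‖z - ζ‖ ≤ 3 := by
        rw [div_le_iff₀ (by linarith)]; linarith
      calc ρ / ‖z - ζ‖ * ‖deriv φ z‖ ≤ 3 * ‖deriv φ z‖ := by gcongr
        _ ≤ _ := by nlinarith [sq_nonneg (‖deriv φ z‖ - 1)]
    · rw [Real.circleAverage_fun_smul, Real.circleAverage_fun_add (circleIntegrable_const _ _ _) i2,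
        Real.circleAverage_const, smul_eq_mul]
      linarith
  have h0 : (0 : ℂ) ∈ closedBall (0 : ℂ) (1 / 2) := by simp
  have hsub2 : closedBall (0 : ℂ) (1 / 2) ⊆ ball 0 R := closedBall_subset_ball (by linarith)
  have hlip : ∀ z ∈ closedBall (0 : ℂ) (1 / 2), ‖φ z - φ 0‖ ≤ 33 := by
    intro z hz
    have := (convex_closedBall (0 : ℂ) (1 / 2)).norm_image_sub_le_of_norm_deriv_le
      (fun x hx => hφ.differentiableAt (isOpen_ball.mem_nhds (hsub2 hx))) hderiv h0 hz
    rw [mem_closedBall_zero_iff] at hz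
    rw [sub_zero] at this
    linarith
  -- On the circle `‖z‖ = 1 / 2`, `‖1 + z * φ z‖ ≥ ‖φ 0‖ / 2 - 1 - 33 / 2 ≥ 2`.
  by_contra! hcon
  have hmax := Complex.norm_le_of_forall_mem_frontier_norm_le (f := fun z => (1 + z * φ z)⁻¹)
    (U := ball (0 : ℂ) (1 / 2)) (C := 1 / 2) isBounded_ball
    (by
      refine DifferentiableOn.diffContOnCl ?_
      rw [closure_ball _ (by norm_num)]
      exact ((differentiableOn_const _).add (differentiableOn_id.mul (hφ.mono hsub2))).inv
        fun z hz => hN z (hsub2 hz))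
    (by
      intro z hz
      rw [frontier_ball _ (by norm_num)] at hz
      have hz' := hlip z (sphere_subset_closedBall hz)
      rw [mem_sphere_zero_iff_norm] at hz
      rw [norm_inv, inv_le_comm₀ (norm_pos_iff.2 (hN z (hsub2 (by simp [hz])))) (by norm_num)]
      have e : z * φ 0 = (1 + z * φ z) - 1 - z * (φ z - φ 0) := by ring
      have e1 : ‖z * φ 0‖ ≤ ‖1 + z * φ z‖ + ‖(1 : ℂ)‖ + ‖z * (φ z - φ 0)‖ := by
        rw [e]
        refine (norm_sub_le _ _).trans ?_
        gcongr
        exact norm_sub_le _ _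
      rw [norm_mul, norm_mul, norm_one, hz] at e1
      norm_num
      linarith)
    (z := 0) (subset_closure (by simp))
  norm_num at hmax

/-- A non-sharp form of Bieberbach's bound on the second coefficient of a univalent function. The
normalized reciprocal `g'(0) / (g z - g 0)` has the form `1 / z + φ z` with
`φ 0 = -g''(0) / (2 g'(0))`. -/
theorem UnivalentOn.norm_deriv_deriv_zero_le {g : ℂ → ℂ} {R : ℝ} (hR : 1 < R)
    (hg : UnivalentOn g (ball 0 R)) : ‖deriv (deriv g) 0‖ ≤ 80 * ‖deriv g 0‖ := by
  have h0 : (0 : ℂ) ∈ ball (0 : ℂ) R := mem_ball_self (by linarith)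
  have hnhds : ball (0 : ℂ) R ∈ 𝓝 0 := isOpen_ball.mem_nhds h0
  set a := deriv g 0 with ha
  have ha0 : a ≠ 0 := hg.deriv_ne_zero isOpen_ball h0
  set q := dslope g 0 with hq
  have hqd : DifferentiableOn ℂ q (ball 0 R) := (Complex.differentiableOn_dslope hnhds).2 hg.1
  have hqg : ∀ z, z * q z = g z - g 0 := by
    intro z
    have := sub_smul_dslope g 0 z
    rwa [sub_zero, smul_eq_mul] at this
  have hq0 : q 0 = a := dslope_same g 0
  have hqne : ∀ z ∈ ball (0 : ℂ) R, q z ≠ 0 := by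
    intro z hz hqz
    by_cases hz0 : z = 0
    · rw [hz0, hq0] at hqz; exact ha0 hqz
    · have := hqg z
      rw [hqz, mul_zero, eq_comm, sub_eq_zero] at this
      exact hz0 (hg.2 hz h0 this)
  set N : ℂ → ℂ := fun z => a / q z with hNdef
  have hNd : DifferentiableOn ℂ N (ball 0 R) := (differentiableOn_const _).div hqd hqne
  have hN0 : N 0 = 1 := by simp [hNdef, hq0, ha0]
  set φ := dslope N 0 with hφ
  have hφd : DifferentiableOn ℂ φ (ball 0 R) := (Complex.differentiableOn_dslope hnhds).2 hNd
  have hφN : ∀ z, 1 + z * φ z = N z := by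
    intro z
    have := sub_smul_dslope N 0 z
    rw [sub_zero, smul_eq_mul, hN0] at this
    rw [this]; ring
  have hGg : ∀ z ∈ ball (0 : ℂ) R \ {0}, z⁻¹ + φ z = a / (g z - g 0) := by
    intro z hz
    have hz0 : z ≠ 0 := hz.2
    have h1 : z⁻¹ + φ z = N z / z := by rw [← hφN]; field_simp
    rw [h1, ← hqg, hNdef]
    have := hqne z hz.1
    field_simp
  have hgne : ∀ z ∈ ball (0 : ℂ) R \ {0}, g z - g 0 ≠ 0 := fun z hz h =>
    hz.2 (hg.2 hz.1 h0 (sub_eq_zero.1 h))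
  have hinj : InjOn (fun z => z⁻¹ + φ z) (ball 0 R \ {0}) := by
    intro z hz w hw hzw
    simp only [hGg z hz, hGg w hw] at hzw
    rw [div_eq_div_iff (hgne z hz) (hgne w hw)] at hzw
    have := mul_left_cancel₀ ha0 hzw
    exact hg.2 hz.1 hw.1 (sub_left_inj.1 this).symm
  have hb := norm_apply_zero_le_of_injOn hR hφd hinj fun z hz => by
    rw [hφN]; exact div_ne_zero ha0 (hqne z hz)
  have hqd0 : HasDerivAt q (deriv q 0) 0 := (hqd.differentiableAt hnhds).hasDerivAt
  have hφ0 : φ 0 = -deriv q 0 / a := by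
    have h1 : φ 0 = deriv N 0 := dslope_same N 0
    have h2 : HasDerivAt N ((0 * q 0 - a * deriv q 0) / q 0 ^ 2) 0 :=
      (hasDerivAt_const 0 a).div hqd0 (hqne 0 h0)
    rw [h1, h2.deriv, hq0]
    field_simp
    ring
  have hg2 : deriv (deriv g) 0 = 2 * deriv q 0 := by
    have h1 : deriv g =ᶠ[𝓝 0] fun z => q z + z * deriv q z := by
      filter_upwards [hnhds] with z hz
      have h2 : HasDerivAt (fun z => g 0 + z * q z) (1 * q z + z * deriv q z) z :=
        ((hasDerivAt_id z).mul
          (hqd.differentiableAt (isOpen_ball.mem_nhds hz)).hasDerivAt).const_add _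
      have h3 : g = fun z => g 0 + z * q z := by ext z; rw [hqg]; ring
      rw [h3, h2.deriv, one_mul]
    have h4 : HasDerivAt (deriv q) (deriv (deriv q) 0) 0 :=
      ((hqd.deriv isOpen_ball).differentiableAt hnhds).hasDerivAt
    have h5 : HasDerivAt (fun z => q z + z * deriv q z)
        (deriv q 0 + (1 * deriv q 0 + 0 * deriv (deriv q) 0)) 0 :=
      hqd0.add ((hasDerivAt_id (0 : ℂ)).mul h4)
    rw [h1.deriv_eq, h5.deriv]
    ring
  rw [hφ0, norm_div, norm_neg, div_le_iff₀ (norm_pos_iff.2 ha0)] at hb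
  rw [hg2, norm_mul, Complex.norm_ofNat]
  linarith

/-! ### Growth of the derivative in the half-plane -/

/-- The second coefficient bound on the disc of centre `z` and radius `z.im`. -/
theorem UnivalentOn.im_mul_norm_deriv_deriv_le {f : ℂ → ℂ}
    (hf : UnivalentOn f UpperHalfPlane.upperHalfPlaneSet) {z : ℂ}
    (hz : z ∈ UpperHalfPlane.upperHalfPlaneSet) :
    z.im * ‖deriv (deriv f) z‖ ≤ 160 * ‖deriv f z‖ := by
  have hz : 0 < z.im := hz
  have hHo : IsOpen UpperHalfPlane.upperHalfPlaneSet := UpperHalfPlane.isOpen_upperHalfPlaneSet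
  set b : ℂ := ((z.im / 2 : ℝ) : ℂ) with hb
  have hb0 : b ≠ 0 := by
    rw [hb, Ne, Complex.ofReal_eq_zero]; linarith
  have hmaps : ∀ w ∈ ball (0 : ℂ) 2, z + b * w ∈ UpperHalfPlane.upperHalfPlaneSet := by
    intro w hw
    rw [mem_ball_zero_iff] at hw
    have h1 := (abs_le.1 (Complex.abs_im_le_norm w)).1
    change 0 < (z + b * w).im
    rw [Complex.add_im, hb, Complex.im_ofReal_mul]
    nlinarith
  have haff : ∀ w, HasDerivAt (fun w => z + b * w) b w := fun w => by
    simpa using ((hasDerivAt_id w).const_mul b).const_add z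
  have hd1 : ∀ w ∈ ball (0 : ℂ) 2,
      HasDerivAt (fun w => f (z + b * w)) (deriv f (z + b * w) * b) w := fun w hw => HasDerivAt.comp w
      (hf.1.differentiableAt (hHo.mem_nhds (hmaps w hw))).hasDerivAt (haff w)
  have hg : UnivalentOn (fun w => f (z + b * w)) (ball 0 2) := by
    refine ⟨fun w hw => (hd1 w hw).differentiableAt.differentiableWithinAt, fun w hw v hv h => ?_⟩
    have := hf.2 (hmaps w hw) (hmaps v hv) h
    exact mul_left_cancel₀ hb0 (add_left_cancel this)
  have h0 : (0 : ℂ) ∈ ball (0 : ℂ) 2 := mem_ball_self (by norm_num)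
  have h2 : deriv (deriv fun w => f (z + b * w)) 0 = deriv (deriv f) z * b * b := by
    have e : deriv (fun w => f (z + b * w)) =ᶠ[𝓝 0] fun w => deriv f (z + b * w) * b := by
      filter_upwards [isOpen_ball.mem_nhds h0] with w hw using (hd1 w hw).deriv
    have h3 : HasDerivAt (fun w => deriv f (z + b * w) * b)
        (deriv (deriv f) (z + b * 0) * b * b) 0 := by
      have h4 : HasDerivAt (deriv f) (deriv (deriv f) (z + b * 0)) (z + b * 0) :=
        ((hf.1.deriv hHo).differentiableAt (hHo.mem_nhds (hmaps 0 h0))).hasDerivAt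
      exact (HasDerivAt.comp (0 : ℂ) h4 (haff 0)).mul_const b
    rw [e.deriv_eq, h3.deriv, mul_zero, add_zero]
  have h4 := hg.norm_deriv_deriv_zero_le one_lt_two
  rw [h2, (hd1 0 h0).deriv, mul_zero, add_zero, norm_mul, norm_mul, norm_mul, ← mul_assoc] at h4
  have h5 := le_of_mul_le_mul_right h4 (norm_pos_iff.2 hb0)
  rw [hb, Complex.norm_real, Real.norm_of_nonneg (by positivity)] at h5
  linarith

/-- Grönwall's inequality along a path whose hyperbolic speed is at most `1`. -/
theorem norm_comp_le_mul_exp {h : ℂ → ℂ} {K : ℝ}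
    (hd : DifferentiableOn ℂ h UpperHalfPlane.upperHalfPlaneSet)
    (hK : ∀ z ∈ UpperHalfPlane.upperHalfPlaneSet, z.im * ‖deriv h z‖ ≤ K * ‖h z‖)
    {γ γ' : ℝ → ℂ} (hγ : ∀ s, HasDerivAt γ (γ' s) s)
    (hpos : ∀ s, 0 < (γ s).im) (hspeed : ∀ s, ‖γ' s‖ ≤ (γ s).im) {T : ℝ} (hT : 0 ≤ T) :
    ‖h (γ T)‖ ≤ ‖h (γ 0)‖ * Real.exp (K * T) := by
  have hder : ∀ s, HasDerivAt (fun s => h (γ s)) (γ' s * deriv h (γ s)) s := by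
    intro s
    have := (hd.differentiableAt (UpperHalfPlane.isOpen_upperHalfPlaneSet.mem_nhds
      (hpos s))).hasDerivAt.scomp s (hγ s)
    rwa [smul_eq_mul] at this
  have := norm_le_gronwallBound_of_norm_deriv_right_le (f := fun s => h (γ s)) (δ := ‖h (γ 0)‖)
    (K := K) (ε := 0) (a := 0) (b := T)
    (fun s _ => (hder s).continuousAt.continuousWithinAt)
    (fun s _ => (hder s).hasDerivWithinAt) le_rfl (fun s _ => by
      rw [norm_mul, add_zero]
      refine le_trans ?_ (hK _ (hpos s))
      gcongr
      exact hspeed s) T ⟨hT, le_rfl⟩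
  rwa [gronwallBound_ε0, sub_zero] at this

/-- A logarithmic derivative of size `O(1 / y)` forces polynomial growth in `‖z‖` and `1 / y`,
by integration from `I` up, then sideways, then down to `z`. -/
theorem norm_le_of_im_mul_norm_deriv_le {h : ℂ → ℂ} {K : ℕ}
    (hd : DifferentiableOn ℂ h UpperHalfPlane.upperHalfPlaneSet)
    (hK : ∀ z ∈ UpperHalfPlane.upperHalfPlaneSet, z.im * ‖deriv h z‖ ≤ K * ‖h z‖)
    {z : ℂ} (hz : 0 < z.im) :
    ‖h z‖ ≤ ‖h Complex.I‖ * Real.exp K * (1 + ‖z‖) ^ (2 * K) / z.im ^ K := by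
  set R : ℝ := 1 + ‖z‖ with hR
  have hR1 : 1 ≤ R := by simp [hR]
  have hR0 : 0 < R := by linarith
  have hre : |z.re| ≤ R := (Complex.abs_re_le_norm z).trans (by simp [hR])
  have him : z.im ≤ R := (le_abs_self _).trans ((Complex.abs_im_le_norm z).trans (by simp [hR]))
  have hexp : ∀ t : ℝ, 0 < t → Real.exp (K * Real.log t) = t ^ K := fun t ht => by
    rw [← Real.log_pow, Real.exp_log (by positivity)]
  have hof : ∀ u u' : ℝ → ℝ, (∀ s, HasDerivAt u (u' s) s) → ∀ c : ℂ, ∀ s,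
      HasDerivAt (fun s => c + (u s : ℂ) * Complex.I) ((u' s : ℂ) * Complex.I) s :=
    fun u u' hu c s => ((hu s).ofReal_comp.mul_const Complex.I).const_add c
  -- Vertically from `I` to `R * I`.
  have h1 : ‖h (R * Complex.I)‖ ≤ ‖h Complex.I‖ * R ^ K := by
    have := norm_comp_le_mul_exp hd hK (hof Real.exp Real.exp Real.hasDerivAt_exp 0)
      (fun s => by simp [Complex.exp_ofReal_re, Real.exp_pos])
      (fun s => by simp [Complex.exp_ofReal_re])
      (Real.log_nonneg hR1)
    rw [hexp R hR0, Real.exp_log hR0] at this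
    simpa using this
  -- Horizontally from `R * I` to `z.re + R * I`.
  have h2 : ‖h (z.re + R * Complex.I)‖ ≤ ‖h (R * Complex.I)‖ * Real.exp K := by
    have := norm_comp_le_mul_exp hd hK (γ := fun s => s * (z.re : ℂ) + R * Complex.I)
      (γ' := fun _ => 1 * (z.re : ℂ))
      (fun s => ((Complex.ofRealCLM.hasDerivAt (x := s)).mul_const _).add_const _)
      (fun s => by simpa using hR0) (fun s => by simpa using hre) zero_le_one
    simpa using this
  -- Vertically down from `z.re + R * I` to `z`.
  have h3 : ‖h z‖ ≤ ‖h (z.re + R * Complex.I)‖ * (R / z.im) ^ K := by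
    have := norm_comp_le_mul_exp hd hK (hof (fun s => R * Real.exp (-s))
      (fun s => R * (Real.exp (-s) * (-1)))
      (fun s => ((hasDerivAt_neg s).exp).const_mul R) z.re)
      (fun s => by
        simp only [Complex.add_im, Complex.ofReal_im, Complex.im_ofReal_mul, Complex.I_im]
        positivity)
      (fun s => by
        simp only [Complex.add_im, Complex.ofReal_im, Complex.im_ofReal_mul, Complex.I_im]
        rw [norm_mul, Complex.norm_I, Complex.norm_real, Real.norm_eq_abs, abs_mul, abs_mul,
          abs_of_pos hR0, abs_of_pos (Real.exp_pos _)]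
        simp)
      (Real.log_nonneg ((one_le_div hz).2 him))
    rw [hexp _ (by positivity), Real.exp_neg, Real.exp_log (by positivity)] at this
    simp only [inv_div, neg_zero, Real.exp_zero, mul_one] at this
    have e : R * (z.im / R) = z.im := by field_simp
    rwa [e, Complex.re_add_im] at this
  calc ‖h z‖ ≤ ‖h Complex.I‖ * R ^ K * Real.exp K * (R / z.im) ^ K := by
        refine h3.trans ?_
        gcongr
        refine h2.trans ?_
        gcongr
    _ = ‖h Complex.I‖ * Real.exp K * R ^ (2 * K) / z.im ^ K := by
        rw [div_pow, two_mul, pow_add]; ring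

/-! ### A Phragmén–Lindelöf principle -/

/-- A Phragmén–Lindelöf principle for the upper half-plane that allows polynomial blow-up at the
boundary in the a priori bound. On the half-disc of radius `R` the maximum principle is applied to
`h z * (1 - z ^ 2 / R ^ 2) ^ n / (1 - ε I z) ^ (m + 1)`: on the semicircle the factor
`‖1 - z ^ 2 / R ^ 2‖ = 2 y / R` absorbs the blow-up, and the denominator absorbs the growth. -/
theorem norm_le_of_norm_le_on_real {h : ℂ → ℂ} {A c : ℝ} {m n : ℕ} (hc0 : 0 < c)
    (hc : ContinuousOn h closedUpperHalfPlane)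
    (hd : DifferentiableOn ℂ h UpperHalfPlane.upperHalfPlaneSet)
    (hbd : ∀ x : ℝ, ‖h x‖ ≤ c)
    (hgr : ∀ z : ℂ, 0 < z.im → ‖h z‖ ≤ A * (1 + ‖z‖) ^ m / z.im ^ n)
    {z : ℂ} (hz : 0 < z.im) : ‖h z‖ ≤ c := by
  have hA0 : 0 ≤ A := by
    have := (norm_nonneg _).trans (hgr Complex.I (by simp))
    simp only [Complex.norm_I, Complex.I_im, one_pow, div_one] at this
    exact nonneg_of_mul_nonneg_left this (by positivity)
  have hden : ∀ ε : ℝ, 0 < ε → ∀ w : ℂ, 0 ≤ w.im →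
      1 ≤ ‖1 - ε * Complex.I * w‖ ∧ ε * ‖w‖ ≤ ‖1 - ε * Complex.I * w‖ := by
    intro ε hε w hw
    have e1 : (1 - ε * Complex.I * w).re = 1 + ε * w.im := by simp
    have e2 : (1 - ε * Complex.I * w).im = -(ε * w.re) := by simp
    have h1 : 0 ≤ ε * w.im := by positivity
    constructor
    · calc (1 : ℝ) ≤ 1 + ε * w.im := by linarith
        _ = (1 - ε * Complex.I * w).re := e1.symm
        _ ≤ _ := Complex.re_le_norm _
    · refine abs_le_of_sq_le_sq' ?_ (norm_nonneg _) |>.2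
      rw [mul_pow, ← Complex.normSq_eq_norm_sq, ← Complex.normSq_eq_norm_sq, Complex.normSq_apply,
        Complex.normSq_apply, e1, e2]
      nlinarith
  have key : ∀ ε : ℝ, 0 < ε → ∀ R : ℝ, 1 ≤ R → ‖z‖ < R →
      A * 2 ^ m * 2 ^ n / ε ^ (m + 1) / R ≤ c →
      ‖h z‖ * ‖1 - z ^ 2 / R ^ 2‖ ^ n ≤ c * ‖1 - ε * Complex.I * z‖ ^ (m + 1) := by
    intro ε hε R hR1 hzR hRc
    have hR0 : 0 < R := by linarith
    have hne : ∀ w : ℂ, 0 ≤ w.im → 1 - ε * Complex.I * w ≠ 0 := fun w hw =>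
      norm_pos_iff.1 (zero_lt_one.trans_le (hden ε hε w hw).1)
    set U : Set ℂ := {w | 0 < w.im} ∩ ball 0 R with hU
    have hUo : IsOpen U := (isOpen_lt continuous_const Complex.continuous_im).inter isOpen_ball
    have hcl : closure U ⊆ {w | 0 ≤ w.im} ∩ closedBall 0 R := by
      refine closure_minimal (fun w hw =>
        ⟨le_of_lt (show 0 < w.im from hw.1), ball_subset_closedBall hw.2⟩) ?_
      exact (isClosed_le continuous_const Complex.continuous_im).inter isClosed_closedBall
    set F : ℂ → ℂ := fun w => h w * (1 - w ^ 2 / R ^ 2) ^ n / (1 - ε * Complex.I * w) ^ (m + 1)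
      with hF
    have hFd : DiffContOnCl ℂ F U := by
      refine ⟨?_, ?_⟩
      · refine DifferentiableOn.div ((hd.mono fun w hw => hw.1).mul (by fun_prop)) (by fun_prop)
          fun w hw => pow_ne_zero _ (hne w (le_of_lt hw.1))
      · refine ContinuousOn.div ((hc.mono fun w hw => (hcl hw).1).mul (by fun_prop)) (by fun_prop)
          fun w hw => pow_ne_zero _ (hne w (hcl hw).1)
    have hFb : ∀ w ∈ frontier U, ‖F w‖ ≤ c := by
      intro w hw
      rw [hUo.frontier_eq] at hw
      obtain ⟨hw0, hwR⟩ := hcl hw.1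
      have hw0 : 0 ≤ w.im := hw0
      rw [mem_closedBall_zero_iff] at hwR
      obtain ⟨hd1, hd2⟩ := hden ε hε w hw0
      have hFn : ‖F w‖ = ‖h w‖ * ‖1 - w ^ 2 / R ^ 2‖ ^ n / ‖1 - ε * Complex.I * w‖ ^ (m + 1) := by
        simp only [hF, norm_div, norm_mul, norm_pow]
      rw [hFn]
      rcases hw0.eq_or_lt with hw0 | hw0
      -- The diameter: both factors have modulus on the favourable side of `1`.
      · have hwre : w = (w.re : ℂ) := Complex.ext (by simp) (by simp [← hw0])
        have h1 : ‖h w‖ ≤ c := by rw [hwre]; exact hbd _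
        have h2 : ‖1 - w ^ 2 / R ^ 2‖ ≤ 1 := by
          have hsq : w.re ^ 2 ≤ R ^ 2 := by
            rw [← sq_abs]
            gcongr
            exact (Complex.abs_re_le_norm w).trans hwR
          have h3 : w.re ^ 2 / R ^ 2 ≤ 1 := by rw [div_le_one (by positivity)]; exact hsq
          have h4 : 0 ≤ w.re ^ 2 / R ^ 2 := by positivity
          rw [hwre]
          have : (1 - (w.re : ℂ) ^ 2 / R ^ 2) = ((1 - w.re ^ 2 / R ^ 2 : ℝ) : ℂ) := by push_cast; rfl
          rw [this, Complex.norm_real, Real.norm_of_nonneg (by linarith)]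
          linarith
        calc _ ≤ c * 1 ^ n / 1 ^ (m + 1) := by gcongr
          _ = c := by simp
      -- The semicircle.
      · have hwn : ‖w‖ = R := by
          refine le_antisymm hwR (not_lt.1 fun hlt => hw.2 ⟨hw0, ?_⟩)
          rwa [mem_ball_zero_iff]
        have h2 : ‖1 - w ^ 2 / R ^ 2‖ = 2 * w.im / R := by
          have e1 : (R : ℂ) ^ 2 = w * (starRingEnd ℂ) w := by
            rw [Complex.mul_conj, Complex.normSq_eq_norm_sq, hwn]; push_cast; rfl
          have hRC : (R : ℂ) ≠ 0 := by exact_mod_cast hR0.ne'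
          have e2 : 1 - w ^ 2 / (R : ℂ) ^ 2 = w * ((starRingEnd ℂ) w - w) / (R : ℂ) ^ 2 := by
            field_simp
            rw [e1]; ring
          have e3 : (starRingEnd ℂ) w - w = -((2 * w.im : ℝ) * Complex.I) := by
            apply Complex.ext <;> simp; ring
          rw [e2, e3, norm_div, norm_mul, norm_neg, norm_mul, Complex.norm_I, Complex.norm_real,
            hwn, norm_pow, Complex.norm_real, Real.norm_of_nonneg (by positivity),
            Real.norm_of_nonneg hR0.le]
          field_simp
        rw [h2]
        rw [hwn] at hd2
        calc ‖h w‖ * (2 * w.im / R) ^ n / ‖1 - ε * Complex.I * w‖ ^ (m + 1)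
            ≤ (A * (R + R) ^ m / w.im ^ n) * (2 * w.im / R) ^ n / (ε * R) ^ (m + 1) := by
              gcongr
              refine (hgr w hw0).trans ?_
              rw [hwn]
              gcongr
          _ = A * 2 ^ m * 2 ^ n / ε ^ (m + 1) / R / R ^ n := by
              rw [← two_mul, mul_pow, mul_pow, div_pow, mul_pow, pow_succ R m]
              field_simp
          _ ≤ A * 2 ^ m * 2 ^ n / ε ^ (m + 1) / R :=
              div_le_self (by positivity) (one_le_pow₀ hR1)
          _ ≤ c := hRc
    have hzU : z ∈ closure U := subset_closure ⟨hz, by rwa [mem_ball_zero_iff]⟩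
    have := Complex.norm_le_of_forall_mem_frontier_norm_le (isBounded_ball.subset inter_subset_right)
      hFd hFb hzU
    simp only [hF, norm_div, norm_mul, norm_pow] at this
    rwa [div_le_iff₀ (pow_pos (norm_pos_iff.2 (hne z hz.le)) _)] at this
  have hlimR : ∀ ε : ℝ, 0 < ε → ‖h z‖ ≤ c * ‖1 - ε * Complex.I * z‖ ^ (m + 1) := by
    intro ε hε
    have ht : Tendsto (fun R : ℝ => ‖h z‖ * ‖1 - z ^ 2 / (R : ℂ) ^ 2‖ ^ n) atTop
        (𝓝 (‖h z‖ * ‖(1 : ℂ) - 0‖ ^ n)) := by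
      have h1 : Tendsto (fun R : ℝ => z ^ 2 / (R : ℂ) ^ 2) atTop (𝓝 0) := by
        rw [tendsto_zero_iff_norm_tendsto_zero]
        have h2 : Tendsto (fun R : ℝ => ‖z ^ 2‖ / R ^ 2) atTop (𝓝 0) :=
          (tendsto_pow_atTop two_ne_zero).const_div_atTop _
        refine h2.congr fun R => ?_
        rw [norm_div, norm_pow (R : ℂ), Complex.norm_real, Real.norm_eq_abs, sq_abs]
      exact ((h1.const_sub 1).norm.pow n).const_mul _
    rw [sub_zero, norm_one, one_pow, mul_one] at ht
    have hsmall : ∀ᶠ R : ℝ in atTop, A * 2 ^ m * 2 ^ n / ε ^ (m + 1) / R < c :=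
      (tendsto_id.const_div_atTop _).eventually_lt_const hc0
    refine le_of_tendsto ht ?_
    filter_upwards [eventually_ge_atTop 1, eventually_gt_atTop ‖z‖, hsmall] with R h1 h2 h3
    exact key ε hε R h1 h2 h3.le
  have ht : Tendsto (fun ε : ℝ => c * ‖1 - (ε : ℂ) * Complex.I * z‖ ^ (m + 1)) (𝓝[>] 0) (𝓝 c) := by
    have hcont : Continuous fun ε : ℝ => c * ‖1 - (ε : ℂ) * Complex.I * z‖ ^ (m + 1) := by fun_prop
    have := hcont.tendsto 0
    simp only [Complex.ofReal_zero, zero_mul, sub_zero, norm_one, one_pow, mul_one] at this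
    exact this.mono_left nhdsWithin_le_nhds
  refine ge_of_tendsto ht ?_
  filter_upwards [self_mem_nhdsWithin] with ε hε using hlimR ε hε

/-! ### Boundary values of the derivative -/

theorem closure_upperHalfPlaneSet :
    closure UpperHalfPlane.upperHalfPlaneSet = closedUpperHalfPlane :=
  Complex.closure_setOfPred_lt_im 0

theorem uniqueDiffOn_closedUpperHalfPlane (𝕜 : Type*) [RCLike 𝕜] [NormedSpace 𝕜 ℂ]
    [IsScalarTower ℝ 𝕜 ℂ] :
    UniqueDiffOn 𝕜 closedUpperHalfPlane := by
  refine uniqueDiffOn_convex_of_isRCLikeNormedField ?_ ?_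
  · exact convex_halfSpace_im_ge 0
  · exact ⟨Complex.I, mem_interior_iff_mem_nhds.2 (mem_of_superset
      (UpperHalfPlane.isOpen_upperHalfPlaneSet.mem_nhds (by simp [UpperHalfPlane.upperHalfPlaneSet]))
      fun z hz => le_of_lt (show 0 < z.im from hz))⟩

/-- The complex derivative of `f`, extended to the closed half-plane by the boundary derivative, is
continuous. It is the value at `1` of the real derivative of the `C¹` extension, which is complex
linear also on the boundary, by continuity. -/
theorem IsC1Extension.exists_continuousOn_deriv {f F : ℂ → ℂ}
    (hf : DifferentiableOn ℂ f UpperHalfPlane.upperHalfPlaneSet) (hF : IsC1Extension f F) :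
    ∃ D : ℂ → ℂ, ContinuousOn D closedUpperHalfPlane ∧
      EqOn D (deriv f) UpperHalfPlane.upperHalfPlaneSet ∧ ∀ x : ℝ, D x = boundaryDeriv F x := by
  have hHo := UpperHalfPlane.isOpen_upperHalfPlaneSet
  obtain ⟨hEq, hC1⟩ := hF
  set E : ℂ → ℂ →L[ℝ] ℂ := fderivWithin ℝ F closedUpperHalfPlane with hE
  have hEc : ContinuousOn E closedUpperHalfPlane :=
    hC1.continuousOn_fderivWithin (uniqueDiffOn_closedUpperHalfPlane ℝ) le_rfl
  have hEH : ∀ z ∈ UpperHalfPlane.upperHalfPlaneSet,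
      E z = (ContinuousLinearMap.toSpanSingleton ℂ (deriv f z)).restrictScalars ℝ := by
    intro z hz
    have h1 : HasDerivAt F (deriv f z) z :=
      (hf.differentiableAt (hHo.mem_nhds hz)).hasDerivAt.congr_of_eventuallyEq
        (by filter_upwards [hHo.mem_nhds hz] with w hw using hEq hw)
    have h2 : closedUpperHalfPlane ∈ 𝓝 z :=
      mem_of_superset (hHo.mem_nhds hz) fun w hw => le_of_lt (show 0 < w.im from hw)
    rw [hE, fderivWithin_of_mem_nhds h2]
    exact (h1.hasFDerivAt.restrictScalars ℝ).fderiv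
  have hlin : ∀ z ∈ closedUpperHalfPlane, ∀ v : ℂ, E z v = v * E z 1 := by
    intro z hz v
    have hcl : EqOn (fun z => E z v) (fun z => v * E z 1) UpperHalfPlane.upperHalfPlaneSet := by
      intro w hw
      simp [hEH w hw]
    refine hcl.of_subset_closure (hEc.clm_apply continuousOn_const)
      (continuousOn_const.mul (hEc.clm_apply continuousOn_const)) ?_ ?_ hz
    · exact fun w hw => le_of_lt (show 0 < w.im from hw)
    · exact closure_upperHalfPlaneSet.ge
  refine ⟨fun z => E z 1, hEc.clm_apply continuousOn_const, fun z hz => ?_, fun x => ?_⟩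
  · simp [hEH z hz]
  · have hx : (x : ℂ) ∈ closedUpperHalfPlane := by simp [closedUpperHalfPlane]
    have h1 : HasFDerivWithinAt F (E x) closedUpperHalfPlane x :=
      (hC1.differentiableOn one_ne_zero x hx).hasFDerivWithinAt
    have h2 : HasDerivWithinAt F (E x 1) closedUpperHalfPlane x := by
      rw [hasDerivWithinAt_iff_hasFDerivWithinAt]
      refine HasFDerivWithinAt.of_isLittleO ?_
      refine h1.isLittleO.congr_left fun w => ?_
      rw [hlin x hx]
      simp
    exact (h2.derivWithin (uniqueDiffOn_closedUpperHalfPlane ℂ x hx)).symm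

/-! ### Bounds for the derivative -/

theorem mainTheorem10 (f F : ℂ → ℂ) (hf : UnivalentOn f UpperHalfPlane.upperHalfPlaneSet)
    (hF : IsC1Extension f F) :
    (∀ c : ℝ, 0 < c → (∀ x : ℝ, ‖boundaryDeriv F x‖ ≤ c) →
        ∀ z ∈ UpperHalfPlane.upperHalfPlaneSet, ‖deriv f z‖ ≤ c) ∧
    (∀ c : ℝ, 0 < c → (∀ x : ℝ, c ≤ ‖boundaryDeriv F x‖) →
        ∀ z ∈ UpperHalfPlane.upperHalfPlaneSet, c ≤ ‖deriv f z‖) ∧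
    ((∃ k : ℝ, ∀ x : ℝ, ‖boundaryDeriv F x‖ = k) →
        ∃ a : ℂ, ∀ z ∈ UpperHalfPlane.upperHalfPlaneSet, deriv f z = a) := by
  have hHo := UpperHalfPlane.isOpen_upperHalfPlaneSet
  obtain ⟨D, hDc, hDH, hDb⟩ := hF.exists_continuousOn_deriv hf.1
  have hdf : DifferentiableOn ℂ (deriv f) UpperHalfPlane.upperHalfPlaneSet := hf.1.deriv hHo
  have hDd : DifferentiableOn ℂ D UpperHalfPlane.upperHalfPlaneSet := hdf.congr hDH
  have hne : ∀ z ∈ UpperHalfPlane.upperHalfPlaneSet, deriv f z ≠ 0 :=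
    fun z hz => hf.deriv_ne_zero hHo hz
  have upper : ∀ c : ℝ, 0 < c → (∀ x : ℝ, ‖boundaryDeriv F x‖ ≤ c) →
      ∀ z ∈ UpperHalfPlane.upperHalfPlaneSet, ‖deriv f z‖ ≤ c := by
    intro c hc hb z hz
    rw [← hDH hz]
    refine norm_le_of_norm_le_on_real (A := ‖deriv f Complex.I‖ * Real.exp (160 : ℕ))
      (m := 2 * 160) (n := 160) hc hDc hDd (fun x => by rw [hDb]; exact hb x)
      (fun w hw => ?_) hz
    rw [hDH hw]
    exact norm_le_of_im_mul_norm_deriv_le (K := 160) hdf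
      (fun v hv => by exact_mod_cast hf.im_mul_norm_deriv_deriv_le hv) hw
  have lower : ∀ c : ℝ, 0 < c → (∀ x : ℝ, c ≤ ‖boundaryDeriv F x‖) →
      ∀ z ∈ UpperHalfPlane.upperHalfPlaneSet, c ≤ ‖deriv f z‖ := by
    intro c hc hb z hz
    have hDne : ∀ w ∈ closedUpperHalfPlane, D w ≠ 0 := by
      intro w hw
      rcases (show 0 ≤ w.im from hw).eq_or_lt with h | h
      · have hwre : w = (w.re : ℂ) := Complex.ext (by simp) (by simp [← h])
        rw [hwre, hDb]
        exact norm_pos_iff.1 (hc.trans_le (hb _))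
      · rw [hDH h]; exact hne w h
    have hsub : UpperHalfPlane.upperHalfPlaneSet ⊆ closedUpperHalfPlane :=
      fun w hw => le_of_lt (show 0 < w.im from hw)
    have h1 := norm_le_of_norm_le_on_real (h := fun w => (D w)⁻¹)
      (A := ‖(deriv f Complex.I)⁻¹‖ * Real.exp (160 : ℕ)) (m := 2 * 160) (n := 160) (inv_pos.2 hc)
      (hDc.inv₀ hDne) (hDd.inv fun w hw => hDne w (hsub hw))
      (fun x => by
        rw [norm_inv, hDb]
        exact inv_anti₀ hc (hb x))
      (fun w hw => by
        rw [hDH hw]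
        refine norm_le_of_im_mul_norm_deriv_le (K := 160) (h := fun w => (deriv f w)⁻¹)
          (hdf.inv hne) (fun v hv => ?_) hw
        have h2 := ((hdf.differentiableAt (hHo.mem_nhds hv)).hasDerivAt.fun_inv (hne v hv)).deriv
        have h3 := hf.im_mul_norm_deriv_deriv_le hv
        have h4 : 0 < ‖deriv f v‖ := norm_pos_iff.2 (hne v hv)
        rw [h2, norm_div, norm_neg, norm_pow, norm_inv, ← mul_div_assoc,
          div_le_iff₀ (by positivity)]
        refine h3.trans (le_of_eq ?_)
        push_cast
        field_simp) hz
    rw [norm_inv, hDH hz] at h1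
    exact (inv_le_inv₀ (norm_pos_iff.2 (hne z hz)) hc).1 h1
  refine ⟨upper, lower, ?_⟩
  rintro ⟨k, hk⟩
  have hk0 : 0 ≤ k := by rw [← hk 0]; exact norm_nonneg _
  have hnorm : ∀ z ∈ UpperHalfPlane.upperHalfPlaneSet, ‖deriv f z‖ = k := by
    intro z hz
    -- For `k = 0` only the upper bound is available, with every positive constant.
    rcases hk0.eq_or_lt with h | h
    · refine le_antisymm (le_of_forall_gt_imp_ge_of_dense fun c hc => ?_) (by simp [← h])
      exact upper c (h ▸ hc) (fun x => by rw [hk]; exact hc.le) z hz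
    · exact le_antisymm (upper k h (fun x => (hk x).le) z hz)
        (lower k h (fun x => (hk x).ge) z hz)
  -- A holomorphic function of constant modulus is constant, by the maximum principle.
  refine ⟨deriv f Complex.I, fun z hz => ?_⟩
  have hI : Complex.I ∈ UpperHalfPlane.upperHalfPlaneSet := by
    simp [UpperHalfPlane.upperHalfPlaneSet]
  refine Complex.eqOn_of_isPreconnected_of_isMaxOn_norm
    (convex_halfSpace_im_gt 0).isPreconnected hHo hdf hI (fun w hw => ?_) hz
  simp [hnorm w hw, hnorm _ hI]
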